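/- Theorem 2. A \emph{Nordstrom--Robinson code} is any binary code $C\subset\mathbb F_2^{16}$ with $256$ codewords and minimum Hamming distance $6$; its kernel is $\mathrm{Ker}(C)=\{x\in\mathbb F_2^{16} : x+C=C\}$. A \emph{Fano plane} on $\{1,\dots,7\}$ is a set $S$ of $3$-element subsets (lines) such that any two distinct points lie on exactly one line. Let $H_{16}$ be an extended Hamming code of length $16$, i.e. a code that, up to a permutation of the coordinates, has the parity-check matrix whose columns are the $16$ vectors $(1,v)$, $v\in\mathbb F_2^4$. Let $N\subset H_{16}$ be a Nordstrom--Robinson code with $0\in N$. Then $N$ can be written as $N=\mathrm{Ker}(N)\cup\bigcup_{i=1}^{7}(a_i+\mathrm{Ker}(N))$ with words $a_1,\dots,a_7$, and for every such representation the following hold. (i) For every Fano plane $S$ on $\{1,\dots,7\}$, the codes $N$ and $a_i+a_j+a_k+N$ with $\{i,j,k\}\in S$ form a partition of $H_{16}$ into Nordstrom--Robinson codes. (ii) Conversely, every partition of $H_{16}$ into Nordstrom--Robinson codes that has $N$ as a member is of the form given in (i) for some Fano plane $S$ on $\{1,\dots,7\}$. -/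

import Mathlib

namespace NordstromRobinson

/-- Binary words of length 16. -/
abbrev Word : Type := Fin 16 → ZMod 2

/-- The translate `x + C` of a code `C` by a word `x`. -/
def translate (x : Word) (C : Set Word) : Set Word := (fun y => x + y) '' C

/-- The kernel of a code: the words `x` with `x + C = C`. -/
def ker (C : Set Word) : Set Word := {x | translate x C = C}

/-- A Nordstrom-Robinson code is any binary code of length 16 with 256 codewords and
minimum Hamming distance 6 (it need not be linear and need not contain the zero word). -/
structure IsNordstromRobinson (C : Set Word) : Prop where
  ncard_eq : C.ncard = 256
  minDist_eq : IsLeast {d : ℕ | ∃ x ∈ C, ∃ y ∈ C, x ≠ y ∧ hammingDist x y = d} 6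

/-- `H` is an extended Hamming code of length 16: for some labelling `v` of the 16 coordinates
by the points of `F_2 ^ 4`, the columns of a parity check matrix of `H` are the vectors
`(1, v i)`. Quantifying over `v` gives all codes obtained by permuting coordinates. -/
def IsExtendedHamming (H : Set Word) : Prop :=
  ∃ v : Fin 16 ≃ (Fin 4 → ZMod 2), H = {x : Word | ∑ i, x i = 0 ∧ ∑ i, x i • v i = 0}

/-- `S` is (the set of lines of) a Fano plane on the seven points `Fin 7`: each line has three
points, and two distinct points lie on exactly one common line. -/
structure IsFanoPlane (S : Set (Finset (Fin 7))) : Prop where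
  card_line : ∀ L ∈ S, L.card = 3
  exists_unique_line : ∀ p q : Fin 7, p ≠ q → ∃! L : Finset (Fin 7), L ∈ S ∧ p ∈ L ∧ q ∈ L

/-- `P` is a partition of `H` into Nordstrom-Robinson codes (`P` is the set of its members). -/
structure IsNRPartition (P : Set (Set Word)) (H : Set Word) : Prop where
  isNR : ∀ C ∈ P, IsNordstromRobinson C
  disjoint : P.PairwiseDisjoint id
  union_eq : ⋃₀ P = H

/-- The family consisting of `N` and of the codes `a i + a j + a k + N` for the lines `{i, j, k}`
of `S`. -/
def lineFamily (N : Set Word) (a : Fin 7 → Word) (S : Set (Finset (Fin 7))) : Set (Set Word) :=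
  insert N {C | ∃ L ∈ S, C = translate (∑ i ∈ L, a i) N}

/-- The representation `N = Ker N ∪ ⋃ i, (a i + Ker N)` of a code through its kernel. -/
def IsKernelRepresentation (N : Set Word) (a : Fin 7 → Word) : Prop :=
  N = ker N ∪ ⋃ i, translate (a i) (ker N)

end NordstromRobinson

/-! Write `R` for `affineCode v`, the Reed-Muller code RM(1,4), which is the dual of the extended
Hamming code `H`. The theorem reduces to the geometry of the subsets of seven points modulo
complementation.

A Nordstrom-Robinson code inside `H` is even and meets Delsarte's linear programming bound with
equality. Hence its Fourier transform vanishes on weights 1 to 4, and its nonzero distances are 6,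
8, 10 and 16 (`IsOptimalEven.tight`, `IsOptimalEven.dist_values`). A second Krawtchouk combination
then makes the code closed under complement. Parseval on a coset of `R` shows that the Fourier
support lies in `H`, so `R` is a group of periods (`IsOptimalEven.add_mem`). The code is therefore a
union of eight cosets of `R`, any two of which differ by a bent function.

If `a` represents the seven cosets other than `R`, every class of `H / R` is a sum of some `a i`,
and the index set is unique up to complement (`IsFrame.exists_sum_add`,
`IsFrame.sum_mem_affineCode_iff`). The translate of `N` by the sum over `L` becomes the union of the
radius-one balls around `L` and its complement (`mem_translate_sum_iff`). This gives `ker N = R`.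
Every Nordstrom-Robinson subcode of `H` is such a translate (`exists_translate_eq`), because large
families of pairwise intersecting edges are stars. So the partitions containing `N` are the
complement-closed perfect one-error-correcting codes of length 7 containing the empty set, namely
the Hamming codes made of the empty set, the lines of a Fano plane and their complements. -/

namespace NordstromRobinson

/-! ### Characters and Krawtchouk polynomials of length 16. -/

open Finset Polynomial

/-- The nontrivial additive character of `ZMod 2`. -/
def sgn (c : ZMod 2) : ℤ := if c = 0 then 1 else -1

lemma sgn_zero : sgn 0 = 1 := rfl

lemma sgn_add (a b : ZMod 2) : sgn (a + b) = sgn a * sgn b := by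
  revert a b; decide

lemma sgn_sum {ι : Type*} (s : Finset ι) (f : ι → ZMod 2) :
    sgn (∑ i ∈ s, f i) = ∏ i ∈ s, sgn (f i) := by
  classical
  induction s using Finset.induction_on with
  | empty => simp [sgn_zero]
  | insert a s ha ih => rw [sum_insert ha, prod_insert ha, sgn_add, ih]

/-- Expanding the product chooses a bit `u i` in each factor. With `t` an indeterminate this is the
generating function of the Krawtchouk values; with `t = 1` it is orthogonality of characters. -/
lemma sum_sgn_mul_pow {ι A : Type*} [Fintype ι] [DecidableEq ι] [CommRing A]
    (z : ι → ZMod 2) (t : A) :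
    ∑ u : ι → ZMod 2, (sgn (u ⬝ᵥ z) : A) * t ^ hammingNorm u = ∏ i, (1 + (sgn (z i) : A) * t) := by
  have h1 : ∀ i, (1 + (sgn (z i) : A) * t) =
      ∑ b : ZMod 2, (sgn (b * z i) : A) * t ^ (if b = 0 then 0 else 1) := by
    intro i
    rw [show (univ : Finset (ZMod 2)) = {0, 1} from rfl, sum_insert (by decide), sum_singleton]
    simp [sgn_zero]
  simp_rw [h1]
  rw [Finset.prod_univ_sum, Fintype.piFinset_univ]
  refine sum_congr rfl fun u _ => ?_
  rw [prod_mul_distrib, dotProduct, sgn_sum, prod_pow_eq_pow_sum]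
  congr 1
  · push_cast; rfl
  · congr 1
    rw [hammingNorm, card_filter]
    refine sum_congr rfl fun i _ => ?_
    by_cases h : u i = 0 <;> simp [h]

lemma sum_sgn_dotProduct {ι : Type*} [Fintype ι] [DecidableEq ι] (z : ι → ZMod 2) :
    ∑ u : ι → ZMod 2, sgn (u ⬝ᵥ z) = if z = 0 then 2 ^ Fintype.card ι else 0 := by
  have h := sum_sgn_mul_pow z (1 : ℤ)
  simp only [one_pow, mul_one, Int.cast_id] at h
  rw [h]
  split_ifs with hz
  · subst hz; simp [sgn_zero]
  · obtain ⟨i, hi⟩ := Function.ne_iff.1 hz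
    refine prod_eq_zero (mem_univ i) ?_
    simp [sgn, show z i ≠ 0 from hi]

lemma sum_sgn (x : Word) : ∑ i, sgn (x i) = 16 - 2 * hammingNorm x := by
  have h : ∀ i, sgn (x i) = 1 - 2 * (if x i ≠ 0 then 1 else 0) := by
    intro i; by_cases h : x i = 0 <;> simp [sgn, h]
  simp_rw [h, sum_sub_distrib, ← mul_sum, hammingNorm, sum_boole]
  simp

/-- The Krawtchouk polynomial of degree `j`, evaluated at the weight of `z`. -/
def kraw (j : ℕ) (z : Word) : ℤ := ∑ u : Word with hammingNorm u = j, sgn (u ⬝ᵥ z)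

lemma card_filter_eq_zero (z : Word) : #{i | ¬ z i ≠ 0} = 16 - hammingNorm z := by
  have := card_filter_add_card_filter_not (s := (univ : Finset (Fin 16))) (fun i => z i ≠ 0)
  rw [card_univ, Fintype.card_fin] at this
  exact Nat.eq_sub_of_add_eq' this

lemma prod_one_add_sgn_mul_X (z : Word) : ∏ i, (1 + (sgn (z i) : ℤ[X]) * X) =
    (1 - X) ^ hammingNorm z * (1 + X) ^ (16 - hammingNorm z) := by
  have : ∀ i, (1 + (sgn (z i) : ℤ[X]) * X) = if z i ≠ 0 then 1 - X else 1 + X := by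
    intro i; by_cases h : z i = 0 <;> simp [sgn, h]; ring
  simp_rw [this]
  rw [prod_ite, prod_const, prod_const, card_filter_eq_zero, hammingNorm]

lemma coeff_one_sub_X_pow (n k : ℕ) : ((1 - X : ℤ[X]) ^ n).coeff k = (-1) ^ k * n.choose k := by
  have : (1 - X : ℤ[X]) ^ n = ((1 + X) ^ n).comp (C (-1) * X) := by simp [sub_eq_add_neg]
  rw [this, comp_C_mul_X_coeff, coeff_one_add_X_pow, mul_comm]

/-- The value of the Krawtchouk polynomial of degree `j` and length `16` at `d`. -/
def krawValue (j d : ℕ) : ℤ :=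
  ∑ p ∈ antidiagonal j, (-1) ^ p.1 * d.choose p.1 * (16 - d).choose p.2

lemma kraw_eq (j : ℕ) (z : Word) : kraw j z = krawValue j (hammingNorm z) := by
  have h := congrArg (fun p => p.coeff j) (sum_sgn_mul_pow z (X : ℤ[X]))
  simp only [prod_one_add_sgn_mul_X, finsetSum_coeff, coeff_mul, coeff_one_sub_X_pow,
    coeff_one_add_X_pow] at h
  refine Eq.trans ?_ h
  rw [kraw, sum_filter]
  refine sum_congr rfl fun u _ => ?_
  rw [← coeff_mul, ← Polynomial.C_eq_intCast, coeff_C_mul_X_pow]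
  simp [eq_comm]

lemma hammingNorm_le (z : Word) : hammingNorm z ≤ 16 := by
  simpa using hammingNorm_le_card_fintype (x := z)

lemma kraw_zero (z : Word) : kraw 0 z = 1 := by
  rw [kraw_eq]; simp [krawValue]

/-- The combination of Krawtchouk polynomials that is optimal for Delsarte's bound on even codes
of length `16` and minimum distance `6`. -/
def lp (z : Word) : ℤ := 60 * kraw 0 z + 60 * kraw 1 z + 18 * kraw 2 z + 12 * kraw 3 z + 3 * kraw 4 z

lemma lp_zero : lp 0 = 15360 := by
  simp only [lp, kraw_eq, hammingNorm_zero]; decide +kernel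

/-- At weight `d` the combination equals `2(d-6)(d-8)(d-10)(d-16)`. It is negative at the remaining
even weights 12 and 14, and its value at 0 is `15360 = 60 * 256`. -/
lemma lp_nonpos (z : Word) (he : Even (hammingNorm z)) (h6 : 6 ≤ hammingNorm z) : lp z ≤ 0 := by
  have h16 := hammingNorm_le z
  simp only [lp, kraw_eq]
  generalize hammingNorm z = d at *
  have key : ∀ d ∈ Finset.Icc 6 16, Even d → 60 * krawValue 0 d + 60 * krawValue 1 d + 18 * krawValue 2 d +
      12 * krawValue 3 d + 3 * krawValue 4 d ≤ 0 := by decide +kernel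
  exact key d (by simp [h6, h16]) he

lemma lp_eq_zero (z : Word) (he : Even (hammingNorm z)) (h6 : 6 ≤ hammingNorm z) (h : lp z = 0) :
    hammingNorm z = 6 ∨ hammingNorm z = 8 ∨ hammingNorm z = 10 ∨ hammingNorm z = 16 := by
  have h16 := hammingNorm_le z
  simp only [lp, kraw_eq] at h
  generalize hammingNorm z = d at *
  have key : ∀ d ∈ Finset.Icc 6 16, Even d → 60 * krawValue 0 d + 60 * krawValue 1 d + 18 * krawValue 2 d +
      12 * krawValue 3 d + 3 * krawValue 4 d = 0 → d = 6 ∨ d = 8 ∨ d = 10 ∨ d = 16 := by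
    decide +kernel
  exact key d (by simp [h6, h16]) he h

/-- With `y = 16 - 2d` the combination is `y(y^2 - 16)/6`, which vanishes at the distances 6, 8, 10
but not at 0 or 16. -/
lemma kraw_one_three (z : Word)
    (h : hammingNorm z = 6 ∨ hammingNorm z = 8 ∨ hammingNorm z = 10) :
    5 * kraw 1 z + kraw 3 z = 0 := by
  simp only [kraw_eq]
  rcases h with h | h | h <;> rw [h] <;> decide +kernel

lemma kraw_one_three_zero : 5 * kraw 1 0 + kraw 3 0 = 640 := by
  simp only [kraw_eq, hammingNorm_zero]; decide +kernel

end NordstromRobinson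

/-! ### Equality in Delsarte's bound and the Fourier support. -/

namespace NordstromRobinson

open Finset

/-- Even codes of length `16` with `256` words and minimum distance at least `6`. -/
structure IsOptimalEven (N : Finset Word) : Prop where
  card_eq : #N = 256
  even : ∀ x ∈ N, Even (hammingNorm x)
  le_dist : ∀ x ∈ N, ∀ y ∈ N, x ≠ y → 6 ≤ hammingNorm (x + y)

/-- The Fourier transform of the indicator function of a code. -/
def fourier (N : Finset Word) (u : Word) : ℤ := ∑ x ∈ N, sgn (u ⬝ᵥ x)

lemma add_self_word (x : Word) : x + x = 0 := CharTwo.add_self_eq_zero x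

lemma add_add_cancel_word (x y : Word) : x + (x + y) = y := by
  rw [← add_assoc, add_self_word, zero_add]

lemma natCast_hammingNorm (x : Word) : (hammingNorm x : ZMod 2) = ∑ i, x i := by
  have h : ∀ c : ZMod 2, c = if c ≠ 0 then 1 else 0 := by decide
  rw [hammingNorm, card_filter, Nat.cast_sum]
  refine sum_congr rfl fun i _ => ?_
  rw [Nat.cast_ite, Nat.cast_one, Nat.cast_zero]
  exact (h _).symm

lemma even_hammingNorm_iff (x : Word) : Even (hammingNorm x) ↔ ∑ i, x i = 0 := by
  rw [← natCast_hammingNorm, ZMod.natCast_eq_zero_iff_even]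

lemma even_hammingNorm_add {x y : Word} (hx : Even (hammingNorm x)) (hy : Even (hammingNorm y)) :
    Even (hammingNorm (x + y)) := by
  rw [even_hammingNorm_iff] at *
  simp [sum_add_distrib, hx, hy]

lemma sum_kraw (N : Finset Word) (j : ℕ) :
    ∑ x ∈ N, ∑ y ∈ N, kraw j (x + y) = ∑ u : Word with hammingNorm u = j, fourier N u ^ 2 := by
  simp_rw [kraw]
  have : ∀ x ∈ N, ∑ y ∈ N, ∑ u : Word with hammingNorm u = j, sgn (u ⬝ᵥ (x + y)) =
      ∑ u : Word with hammingNorm u = j, sgn (u ⬝ᵥ x) * fourier N u := by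
    intro x _
    rw [sum_comm]
    refine sum_congr rfl fun u _ => ?_
    rw [fourier, mul_sum]
    exact sum_congr rfl fun y _ => by rw [dotProduct_add, sgn_add]
  rw [sum_congr rfl this, sum_comm]
  refine sum_congr rfl fun u _ => ?_
  rw [← sum_mul, sq]; rfl

lemma sum_kraw_left (N : Finset Word) (j : ℕ) (x : Word) (h : ∀ u, hammingNorm u = j → fourier N u = 0) :
    ∑ y ∈ N, kraw j (x + y) = 0 := by
  simp_rw [kraw]
  rw [sum_comm]
  refine sum_eq_zero fun u hu => ?_
  have : ∑ y ∈ N, sgn (u ⬝ᵥ (x + y)) = sgn (u ⬝ᵥ x) * fourier N u := by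
    rw [fourier, mul_sum]
    exact sum_congr rfl fun y _ => by rw [dotProduct_add, sgn_add]
  rw [this, h u (mem_filter.1 hu).2, mul_zero]

lemma IsOptimalEven.even_add {N : Finset Word} (hN : IsOptimalEven N) {x y : Word} (hx : x ∈ N)
    (hy : y ∈ N) : Even (hammingNorm (x + y)) :=
  even_hammingNorm_add (hN.even x hx) (hN.even y hy)

lemma IsOptimalEven.lp_nonpos {N : Finset Word} (hN : IsOptimalEven N) {x y : Word} (hx : x ∈ N)
    (hy : y ∈ N) (h : x ≠ y) : lp (x + y) ≤ 0 :=
  NordstromRobinson.lp_nonpos _ (hN.even_add hx hy) (hN.le_dist x hx y hy h)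

lemma sum_lp (N : Finset Word) :
    ∑ x ∈ N, ∑ y ∈ N, lp (x + y) = 60 * (#N : ℤ) ^ 2 +
      60 * (∑ u : Word with hammingNorm u = 1, fourier N u ^ 2) +
      18 * (∑ u : Word with hammingNorm u = 2, fourier N u ^ 2) +
      12 * (∑ u : Word with hammingNorm u = 3, fourier N u ^ 2) +
      3 * (∑ u : Word with hammingNorm u = 4, fourier N u ^ 2) := by
  simp_rw [← sum_kraw, lp, kraw_zero, sum_add_distrib, ← mul_sum]
  simp; ring

lemma sum_lp_eq (N : Finset Word) :
    ∑ x ∈ N, ∑ y ∈ N, lp (x + y) = 15360 * (#N : ℤ) + ∑ x ∈ N, ∑ y ∈ N.erase x, lp (x + y) := by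
  have : ∀ x ∈ N, ∑ y ∈ N, lp (x + y) = 15360 + ∑ y ∈ N.erase x, lp (x + y) := by
    intro x hx
    rw [← add_sum_erase N _ hx, add_self_word, lp_zero]
  rw [sum_congr rfl this, sum_add_distrib, sum_const]
  simp [mul_comm]

lemma IsOptimalEven.sum_erase_nonpos {N : Finset Word} (hN : IsOptimalEven N) {x : Word}
    (hx : x ∈ N) : ∑ y ∈ N.erase x, lp (x + y) ≤ 0 :=
  sum_nonpos fun _ hy => hN.lp_nonpos hx (mem_of_mem_erase hy) (ne_of_mem_erase hy).symm

/-- The diagonal contributes `15360 * 256 = 60 * 256^2`, exactly the contribution of degree 0 on the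
dual side. What remains is a nonpositive sum equal to a nonnegative one. -/
lemma IsOptimalEven.tight {N : Finset Word} (hN : IsOptimalEven N) :
    (∀ j ∈ Icc 1 4, ∑ u : Word with hammingNorm u = j, fourier N u ^ 2 = 0) ∧
      ∑ x ∈ N, ∑ y ∈ N.erase x, lp (x + y) = 0 := by
  have h1 := sum_lp N
  rw [sum_lp_eq, hN.card_eq] at h1
  have h2 : ∑ x ∈ N, ∑ y ∈ N.erase x, lp (x + y) ≤ 0 := sum_nonpos fun x hx => hN.sum_erase_nonpos hx
  have h3 : ∀ j, 0 ≤ ∑ u : Word with hammingNorm u = j, fourier N u ^ 2 :=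
    fun j => sum_nonneg fun u _ => sq_nonneg _
  have a1 := h3 1
  have a2 := h3 2
  have a3 := h3 3
  have a4 := h3 4
  norm_num at h1
  refine ⟨fun j hj => ?_, by linarith⟩
  obtain rfl | rfl | rfl | rfl : j = 1 ∨ j = 2 ∨ j = 3 ∨ j = 4 := by
    rw [mem_Icc] at hj; omega
  all_goals linarith

lemma IsOptimalEven.fourier_eq_zero {N : Finset Word} (hN : IsOptimalEven N) {u : Word}
    (h1 : 1 ≤ hammingNorm u) (h4 : hammingNorm u ≤ 4) : fourier N u = 0 := by
  have h := hN.tight.1 _ (mem_Icc.2 ⟨h1, h4⟩)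
  rw [sum_eq_zero_iff_of_nonneg fun _ _ => sq_nonneg _] at h
  exact pow_eq_zero_iff (two_ne_zero) |>.1 (h u (by simp))

lemma IsOptimalEven.dist_values {N : Finset Word} (hN : IsOptimalEven N) {x y : Word} (hx : x ∈ N)
    (hy : y ∈ N) (h : x ≠ y) : hammingNorm (x + y) = 6 ∨ hammingNorm (x + y) = 8 ∨
      hammingNorm (x + y) = 10 ∨ hammingNorm (x + y) = 16 := by
  refine lp_eq_zero _ (hN.even_add hx hy) (hN.le_dist x hx y hy h) ?_
  have h0 := hN.tight.2
  rw [sum_eq_zero_iff_of_nonpos fun x hx => hN.sum_erase_nonpos hx] at h0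
  have h1 := h0 x hx
  rw [sum_eq_zero_iff_of_nonpos fun _ hy => hN.lp_nonpos hx (mem_of_mem_erase hy)
    (ne_of_mem_erase hy).symm] at h1
  exact h1 y (mem_erase.2 ⟨h.symm, hy⟩)

lemma eq_one_of_hammingNorm {z : Word} (h : hammingNorm z = 16) : z = 1 := by
  funext i
  have h1 : #{i | z i ≠ 0} = Fintype.card (Fin 16) := h
  rw [card_eq_iff_eq_univ] at h1
  have h2 : ∀ c : ZMod 2, c ≠ 0 → c = 1 := by decide
  have h3 : i ∈ ({i | z i ≠ 0} : Finset (Fin 16)) := by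
    rw [h1]; exact mem_univ i
  exact h2 _ (mem_filter.1 h3).2

/-- Without the antipode of `x`, the only distances from `x` are 0, 6, 8, 10. The sum of `5 * kraw 1
+ kraw 3` would then be 640, while the vanishing of the transform on weights 1 and 3 makes it 0. -/
lemma IsOptimalEven.one_add_mem {N : Finset Word} (hN : IsOptimalEven N) {x : Word} (hx : x ∈ N) :
    1 + x ∈ N := by
  by_contra hne
  have h1 : ∑ y ∈ N, (5 * kraw 1 (x + y) + kraw 3 (x + y)) = 0 := by
    rw [sum_add_distrib, ← mul_sum, sum_kraw_left, sum_kraw_left]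
    · simp
    all_goals exact fun u hu => hN.fourier_eq_zero (by omega) (by omega)
  rw [sum_eq_single_of_mem x hx, add_self_word, kraw_one_three_zero] at h1
  · norm_num at h1
  · intro y hy hyx
    refine kraw_one_three _ ?_
    rcases hN.dist_values hx hy hyx.symm with h | h | h | h
    · exact Or.inl h
    · exact Or.inr (Or.inl h)
    · exact Or.inr (Or.inr h)
    · refine absurd ?_ hne
      rw [← eq_one_of_hammingNorm h, add_comm, add_add_cancel_word]
      exact hy

lemma IsOptimalEven.fourier_odd {N : Finset Word} (hN : IsOptimalEven N) {u : Word}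
    (hu : ¬ Even (hammingNorm u)) : fourier N u = 0 := by
  have h1 : ∀ x, sgn (u ⬝ᵥ (1 + x)) = - sgn (u ⬝ᵥ x) := by
    intro x
    rw [even_hammingNorm_iff, ← dotProduct_one] at hu
    rw [dotProduct_add, sgn_add, sgn, if_neg hu, neg_one_mul]
  have h2 : fourier N u = - fourier N u := by
    rw [fourier, ← sum_neg_distrib]
    refine sum_bij' (fun x _ => 1 + x) (fun x _ => 1 + x) (fun x hx => hN.one_add_mem hx)
      (fun x hx => hN.one_add_mem hx) (fun x _ => add_add_cancel_word _ _)
      (fun x _ => add_add_cancel_word _ _) (fun x _ => by rw [h1, neg_neg])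
  omega

lemma sum_fourier (N : Finset Word) (x : Word) :
    ∑ u, fourier N u * sgn (u ⬝ᵥ x) = if x ∈ N then 2 ^ 16 else 0 := by
  simp_rw [fourier, sum_mul, ← sgn_add, ← dotProduct_add]
  rw [sum_comm]
  simp_rw [sum_sgn_dotProduct]
  have : ∀ y : Word, y + x = 0 ↔ y = x := fun y => by
    rw [← sub_eq_zero (a := y), CharTwo.sub_eq_add]
  simp_rw [this]
  rw [sum_ite_eq']
  simp

/-- By Fourier inversion, a word orthogonal to the Fourier support is a period of the indicator
function. -/
lemma add_mem_of_fourier {N : Finset Word} {c x : Word}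
    (hc : ∀ u, fourier N u ≠ 0 → u ⬝ᵥ c = 0) (hx : x ∈ N) : c + x ∈ N := by
  have h1 : ∑ u, fourier N u * sgn (u ⬝ᵥ (c + x)) = ∑ u, fourier N u * sgn (u ⬝ᵥ x) := by
    refine sum_congr rfl fun u _ => ?_
    by_cases h : fourier N u = 0
    · simp [h]
    · rw [dotProduct_add, hc u h, zero_add]
  rw [sum_fourier, sum_fourier, if_pos hx] at h1
  by_contra h
  simp [h] at h1

end NordstromRobinson

/-! ### The affine code, its dual Hamming code, and bent cosets. -/

namespace NordstromRobinson

open Finset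

/-- The number of common nonzero positions has the parity of the dot product. -/
lemma hammingNorm_add_dot (x y : Word) : ∃ k : ℕ, (k : ZMod 2) = x ⬝ᵥ y ∧
    hammingNorm (x + y) + 2 * k = hammingNorm x + hammingNorm y := by
  have h : ∀ a b : ZMod 2, (if a + b ≠ 0 then 1 else 0) + 2 * (if a * b ≠ 0 then 1 else 0) =
    (if a ≠ 0 then 1 else 0) + (if b ≠ 0 then 1 else 0 : ℕ) := by decide
  have h2 : ∀ c : ZMod 2, ((if c ≠ 0 then 1 else 0 : ℕ) : ZMod 2) = c := by decide
  refine ⟨∑ i, if x i * y i ≠ 0 then 1 else 0, ?_, ?_⟩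
  · rw [Nat.cast_sum]
    exact sum_congr rfl fun i _ => h2 _
  · simp only [hammingNorm, card_filter, mul_sum, ← sum_add_distrib]
    exact sum_congr rfl fun i _ => h _ _

variable (v : Fin 16 ≃ (Fin 4 → ZMod 2))

/-- The word of the affine function `p ↦ c + l ⬝ᵥ p`, for a labelling of the coordinates by the
points of `F_2 ^ 4`. -/
def affineWord (c : ZMod 2) (l : Fin 4 → ZMod 2) : Word := fun i => c + l ⬝ᵥ v i

lemma affineWord_add (c c' : ZMod 2) (l l' : Fin 4 → ZMod 2) :
    affineWord v c l + affineWord v c' l' = affineWord v (c + c') (l + l') := by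
  funext i
  simp only [Pi.add_apply, affineWord, add_dotProduct]
  ring

/-- The Reed-Muller code of words of affine functions. -/
def affineCode : AddSubgroup Word where
  carrier := {x | ∃ c l, affineWord v c l = x}
  zero_mem' := ⟨0, 0, by funext i; simp [affineWord]⟩
  add_mem' := by
    rintro _ _ ⟨c, l, rfl⟩ ⟨c', l', rfl⟩
    exact ⟨_, _, (affineWord_add v c c' l l').symm⟩
  neg_mem' := by
    rintro _ ⟨c, l, rfl⟩
    exact ⟨c, l, (CharTwo.neg_eq _).symm⟩

/-- The extended Hamming code of a labelling of the coordinates. -/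
def hammingCode : AddSubgroup Word where
  carrier := {x : Word | ∑ i, x i = 0 ∧ ∑ i, x i • v i = 0}
  zero_mem' := by simp
  add_mem' := by
    rintro x y ⟨h1, h2⟩ ⟨h3, h4⟩
    simp [sum_add_distrib, add_smul, h1, h2, h3, h4]
  neg_mem' := by
    rintro x ⟨h1, h2⟩
    simp [h1, h2]

lemma affineWord_mem (c : ZMod 2) (l : Fin 4 → ZMod 2) : affineWord v c l ∈ affineCode v :=
  ⟨c, l, rfl⟩

lemma one_mem_affineCode : (1 : Word) ∈ affineCode v := ⟨1, 0, by funext i; simp [affineWord]⟩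

lemma dotProduct_affineWord (x : Word) (c : ZMod 2) (l : Fin 4 → ZMod 2) :
    x ⬝ᵥ affineWord v c l = c * ∑ i, x i + l ⬝ᵥ ∑ i, x i • v i := by
  rw [dotProduct_sum, dotProduct, mul_sum, ← sum_add_distrib]
  refine sum_congr rfl fun i _ => ?_
  rw [affineWord, dotProduct_smul, smul_eq_mul]
  ring

lemma dotProduct_eq_zero {x r : Word} (hx : x ∈ hammingCode v) (hr : r ∈ affineCode v) :
    x ⬝ᵥ r = 0 := by
  obtain ⟨c, l, rfl⟩ := hr
  rw [dotProduct_affineWord, hx.1, hx.2]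
  simp

lemma mem_hammingCode_of_dotProduct {x : Word} (h : ∀ r ∈ affineCode v, x ⬝ᵥ r = 0) :
    x ∈ hammingCode v := by
  have h1 : ∑ i, x i = 0 := by
    have := h _ (one_mem_affineCode v)
    rwa [dotProduct_one] at this
  refine ⟨h1, ?_⟩
  rw [← dotProduct_eq_zero_iff]
  intro l
  have := h _ (affineWord_mem v 0 l)
  rwa [dotProduct_affineWord, h1, mul_zero, zero_add, dotProduct_comm] at this

lemma sum_sgn_dotProduct_labelling (l : Fin 4 → ZMod 2) :
    ∑ i, sgn (l ⬝ᵥ v i) = if l = 0 then 16 else 0 := by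
  rw [Equiv.sum_comp v (fun p => sgn (l ⬝ᵥ p))]
  simp_rw [dotProduct_comm l]
  rw [sum_sgn_dotProduct]
  simp

lemma hammingNorm_affineWord (c : ZMod 2) (l : Fin 4 → ZMod 2) :
    (16 - 2 * hammingNorm (affineWord v c l) : ℤ) = sgn c * if l = 0 then 16 else 0 := by
  rw [← sum_sgn, ← sum_sgn_dotProduct_labelling v, mul_sum]
  exact sum_congr rfl fun i _ => sgn_add _ _

lemma four_dvd_hammingNorm {r : Word} (hr : r ∈ affineCode v) : 4 ∣ hammingNorm r := by
  obtain ⟨c, l, rfl⟩ := hr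
  have h := hammingNorm_affineWord v c l
  rw [sgn] at h
  split_ifs at h <;> omega

lemma affineCode_le_hammingCode : affineCode v ≤ hammingCode v := by
  intro x hx
  refine mem_hammingCode_of_dotProduct v fun r hr => ?_
  obtain ⟨k, hk, h⟩ := hammingNorm_add_dot x r
  have h1 := four_dvd_hammingNorm v hx
  have h2 := four_dvd_hammingNorm v hr
  have h3 := four_dvd_hammingNorm v ((affineCode v).add_mem hx hr)
  rw [← hk, ZMod.natCast_eq_zero_iff]
  omega

lemma parseval_affineCode (x : Word) :
    ∑ c, ∑ l, (16 - 2 * hammingNorm (x + affineWord v c l) : ℤ) ^ 2 = 512 := by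
  have h1 : ∀ c l, (16 - 2 * hammingNorm (x + affineWord v c l) : ℤ) ^ 2 =
      ∑ i, ∑ j, sgn (x i + x j) * sgn (l ⬝ᵥ (v i + v j)) := by
    intro c l
    rw [← sum_sgn, sq, sum_mul_sum]
    refine sum_congr rfl fun i _ => sum_congr rfl fun j _ => ?_
    rw [← sgn_add, ← sgn_add, dotProduct_add]
    simp only [Pi.add_apply, affineWord]
    congr 1
    linear_combination CharTwo.add_self_eq_zero c
  have h2 : ∀ c : ZMod 2, ∑ l, (16 - 2 * hammingNorm (x + affineWord v c l) : ℤ) ^ 2 = 256 := by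
    intro c
    simp_rw [h1]
    rw [sum_comm]
    have : ∀ i, ∑ l, ∑ j, sgn (x i + x j) * sgn (l ⬝ᵥ (v i + v j)) = 16 := by
      intro i
      rw [sum_comm]
      simp_rw [← mul_sum, sum_sgn_dotProduct]
      have : ∀ j, v i + v j = 0 ↔ j = i := fun j => by
        rw [← v.injective.eq_iff, ← sub_eq_zero (a := v j), CharTwo.sub_eq_add, add_comm]
      simp_rw [this]
      simp [sgn_zero, CharTwo.add_self_eq_zero]
    simp_rw [this]
    simp
  simp_rw [h2]
  simp

/-- If all words of a coset of the affine code have weights between `6` and `10`, the coset is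
that of a bent function: all weights are `6` or `10`. -/
lemma bent_of_bounds {x : Word} (h : ∀ r ∈ affineCode v, 6 ≤ hammingNorm (x + r)) :
    ∀ r ∈ affineCode v, hammingNorm (x + r) = 6 ∨ hammingNorm (x + r) = 10 := by
  have hle : ∀ r ∈ affineCode v, hammingNorm (x + r) ≤ 10 := by
    intro r hr
    -- Complementation preserves the coset, so the lower bound 6 yields the upper bound 10.
    have h1 := h _ (add_mem hr (one_mem_affineCode v))
    have h2 := sum_sgn (x + r)
    have h3 := sum_sgn (x + (r + 1))
    have h4 : ∑ i, sgn ((x + (r + 1)) i) = - ∑ i, sgn ((x + r) i) := by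
      rw [← sum_neg_distrib]
      refine sum_congr rfl fun i _ => ?_
      rw [← add_assoc, Pi.add_apply _ 1, sgn_add]
      simp [sgn]
    omega
  have hsq : ∀ c l, (16 - 2 * hammingNorm (x + affineWord v c l) : ℤ) ^ 2 ≤ 16 := by
    intro c l
    have h1 := h _ (affineWord_mem v c l)
    have h2 := hle _ (affineWord_mem v c l)
    have h3 : (6 : ℤ) ≤ hammingNorm (x + affineWord v c l) := by exact_mod_cast h1
    have h4 : (hammingNorm (x + affineWord v c l) : ℤ) ≤ 10 := by exact_mod_cast h2
    nlinarith
  have heq : ∑ p : ZMod 2 × (Fin 4 → ZMod 2),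
      (16 - 2 * hammingNorm (x + affineWord v p.1 p.2) : ℤ) ^ 2 =
      ∑ p : ZMod 2 × (Fin 4 → ZMod 2), (16 : ℤ) := by
    rw [Fintype.sum_prod_type, parseval_affineCode]
    simp
  -- The 32 squares are at most 16 each and sum to 512, so all of them equal 16.
  rw [sum_eq_sum_iff_of_le fun p _ => hsq p.1 p.2] at heq
  rintro _ ⟨c, l, rfl⟩
  have h1 := heq (c, l) (mem_univ _)
  have h3 : (16 - 2 * hammingNorm (x + affineWord v c l) : ℤ) ^ 2 = 4 ^ 2 := h1
  rcases sq_eq_sq_iff_eq_or_eq_neg.1 h3 with h | h <;> omega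

/-- The coset has all weights 2 modulo 4 and `r` has weight 0 modulo 4, so `x` and `r` overlap in an
even number of places. -/
lemma mem_hammingCode_of_bounds {x : Word} (h : ∀ r ∈ affineCode v, 6 ≤ hammingNorm (x + r)) :
    x ∈ hammingCode v := by
  refine mem_hammingCode_of_dotProduct v fun r hr => ?_
  obtain ⟨k, hk, h1⟩ := hammingNorm_add_dot x r
  have h2 := four_dvd_hammingNorm v hr
  have h3 := bent_of_bounds v h r hr
  have h4 := bent_of_bounds v h 0 (zero_mem _)
  rw [add_zero] at h4
  rw [← hk, ZMod.natCast_eq_zero_iff]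
  omega

lemma even_of_mem {x : Word} (hx : x ∈ hammingCode v) : Even (hammingNorm x) :=
  (even_hammingNorm_iff x).2 hx.1

variable {v}

/-- The transform is constant on cosets of the affine code. On a nontrivial coset of the support,
odd weights and weights up to 4 are excluded, so the coset is bent. -/
lemma IsOptimalEven.mem_of_fourier_ne_zero {N : Finset Word} (hN : IsOptimalEven N)
    (hH : ∀ x ∈ N, x ∈ hammingCode v) {u : Word} (hu : fourier N u ≠ 0) : u ∈ hammingCode v := by
  have hinv : ∀ r ∈ affineCode v, fourier N (u + r) = fourier N u := by
    intro r hr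
    refine sum_congr rfl fun x hx => ?_
    rw [add_dotProduct, dotProduct_comm r, dotProduct_eq_zero v (hH x hx) hr, add_zero]
  by_cases hR : u ∈ affineCode v
  · exact affineCode_le_hammingCode v hR
  refine mem_hammingCode_of_bounds v fun r hr => ?_
  have h0 : fourier N (u + r) ≠ 0 := by rwa [hinv r hr]
  have h1 : Even (hammingNorm (u + r)) := by
    by_contra h
    exact h0 (hN.fourier_odd h)
  have h2 : hammingNorm (u + r) ≠ 0 := by
    intro h
    rw [hammingNorm_eq_zero] at h
    exact hR (by rwa [eq_neg_of_add_eq_zero_left h, neg_mem_iff])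
  by_contra h3
  refine h0 (hN.fourier_eq_zero (by omega) ?_)
  rcases h1 with ⟨k, hk⟩
  omega

lemma IsOptimalEven.add_mem {N : Finset Word} (hN : IsOptimalEven N)
    (hH : ∀ x ∈ N, x ∈ hammingCode v) {r x : Word} (hr : r ∈ affineCode v) (hx : x ∈ N) :
    r + x ∈ N :=
  add_mem_of_fourier (fun _ hu => dotProduct_eq_zero v (hN.mem_of_fourier_ne_zero hH hu) hr) hx

/-- Two words of the code lie in the same coset of the affine code or differ by a bent function. -/
lemma IsOptimalEven.add_mem_or {N : Finset Word} (hN : IsOptimalEven N)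
    (hH : ∀ x ∈ N, x ∈ hammingCode v) {x y : Word} (hx : x ∈ N) (hy : y ∈ N) :
    x + y ∈ affineCode v ∨ hammingNorm (x + y) % 4 = 2 := by
  by_cases hR : x + y ∈ affineCode v
  · exact Or.inl hR
  right
  have h : ∀ r ∈ affineCode v, 6 ≤ hammingNorm (x + y + r) := by
    intro r hr
    rw [add_assoc]
    refine hN.le_dist x hx _ (add_comm y r ▸ hN.add_mem hH hr hy) ?_
    rintro rfl
    rw [add_right_comm, add_self_word, zero_add] at hR
    exact hR hr
  have h4 := bent_of_bounds v h 0 (zero_mem _)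
  rw [add_zero] at h4
  omega

lemma affineWord_injective :
    Function.Injective fun p : ZMod 2 × (Fin 4 → ZMod 2) => affineWord v p.1 p.2 := by
  rintro ⟨c, l⟩ ⟨c', l'⟩ h
  have h1 : ∀ p, c + l ⬝ᵥ p = c' + l' ⬝ᵥ p := by
    intro p
    simpa [affineWord] using congrFun h (v.symm p)
  have h2 : c = c' := by simpa using h1 0
  subst h2
  refine Prod.ext rfl (dotProduct_eq _ _ fun p => ?_)
  exact add_left_cancel (h1 p)

lemma card_affineCode : Nat.card (affineCode v) = 32 := by
  have : (affineCode v : Set Word) =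
      Set.range fun p : ZMod 2 × (Fin 4 → ZMod 2) => affineWord v p.1 p.2 := by
    ext x
    simp [affineCode]
  rw [← SetLike.coe_sort_coe, this, Nat.card_range_of_injective affineWord_injective]
  simp

/-- Double counting of characters: 32 times the cardinality equals `2 ^ 16`. -/
lemma card_hammingCode : Nat.card (hammingCode v) = 2048 := by
  classical
  have h1 : ∀ x : Word, ∑ p : ZMod 2 × (Fin 4 → ZMod 2), sgn (x ⬝ᵥ affineWord v p.1 p.2) =
      if x ∈ hammingCode v then 32 else 0 := by
    intro x
    split_ifs with h
    · simp_rw [dotProduct_eq_zero v h (affineWord_mem v _ _)]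
      simp [sgn_zero]
    · simp_rw [dotProduct_affineWord, sgn_add]
      rw [Fintype.sum_prod_type]
      simp_rw [← mul_sum, ← sum_mul]
      rw [sum_sgn_dotProduct]
      by_cases h2 : ∑ i, x i • v i = 0
      · have h3 : ∑ i, x i ≠ 0 := fun h3 => h ⟨h3, h2⟩
        rw [show (univ : Finset (ZMod 2)) = {0, 1} from rfl, sum_insert (by decide), sum_singleton]
        simp [sgn, h3]
      · rw [if_neg h2, mul_zero]
  have h2 := sum_comm (s := univ) (t := univ)
    (f := fun (x : Word) (p : ZMod 2 × (Fin 4 → ZMod 2)) => sgn (x ⬝ᵥ affineWord v p.1 p.2))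
  simp_rw [h1, sum_sgn_dotProduct] at h2
  have h3 : ∀ p : ZMod 2 × (Fin 4 → ZMod 2), affineWord v p.1 p.2 = 0 ↔ p = 0 := by
    intro p
    rw [← affineWord_injective.eq_iff (a := p) (b := 0) (f := fun p => affineWord v p.1 p.2)]
    have : affineWord v (0 : ZMod 2 × (Fin 4 → ZMod 2)).1 (0 : ZMod 2 × (Fin 4 → ZMod 2)).2 = 0 := by
      funext i; simp [affineWord]
    rw [this]
  simp_rw [h3] at h2
  rw [sum_ite_eq', ← sum_filter, sum_const] at h2
  have h4 : #{x | x ∈ hammingCode v} = Nat.card (hammingCode v) := by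
    rw [Nat.card_eq_fintype_card, Fintype.card_subtype]
  rw [h4] at h2
  simp only [nsmul_eq_mul, mem_univ, if_true, Fintype.card_fin] at h2
  omega

end NordstromRobinson

/-! ### Subsets of seven points modulo complement as coordinates on the cosets. -/

namespace NordstromRobinson

open Finset
open scoped symmDiff

/-- Nonempty distinct sets `A`, `B`, `C` from a family of sets of size at most two with small
pairwise symmetric differences correspond to pairwise intersecting edges of a complete graph. -/
lemma symmDiff_inter_of_small :
    ∀ A ∈ (univ : Finset (Finset (Fin 7))).filter (#· ≤ 2),
    ∀ B ∈ (univ : Finset (Finset (Fin 7))).filter (#· ≤ 2), A ≠ ∅ → B ≠ ∅ → A ≠ B →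
      #(A ∆ B) ≤ 2 → ∀ C ∈ (univ : Finset (Finset (Fin 7))).filter (#· ≤ 2),
      #(A ∆ C) ≤ 2 → #(B ∆ C) ≤ 2 →
        (#(C ∆ (A ∩ B)) ≤ 1 ∨ C = A ∆ B) ∧
        (#((A ∆ B) ∆ C) ≤ 2 → C = ∅ ∨ C = A ∨ C = B ∨ C = A ∆ B) := by
  decide +kernel

/-- Read a singleton as an edge to an eighth point. Pairwise intersecting edges form a star or a
triangle, and a triangle together with `∅` has only four members. The centre `T` is the common
vertex, with `∅` standing for the eighth point. -/
lemma exists_center {F : Finset (Finset (Fin 7))} (h5 : 5 ≤ #F) (h0 : ∅ ∈ F)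
    (h2 : ∀ A ∈ F, #A ≤ 2) (hF : ∀ A ∈ F, ∀ B ∈ F, #(A ∆ B) ≤ 2) :
    ∃ T, ∀ A ∈ F, #(A ∆ T) ≤ 1 := by
  have hmem : ∀ A ∈ F, A ∈ (univ : Finset (Finset (Fin 7))).filter (#· ≤ 2) :=
    fun A hA => mem_filter.2 ⟨mem_univ A, h2 A hA⟩
  have h1 : 1 < #(F.erase ∅) := by rw [card_erase_of_mem h0]; omega
  obtain ⟨A, hA, B, hB, hAB⟩ := one_lt_card.1 h1
  rw [mem_erase] at hA hB
  have key := symmDiff_inter_of_small A (hmem A hA.2) B (hmem B hB.2) hA.1 hB.1 hAB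
    (hF A hA.2 B hB.2)
  by_cases hD : A ∆ B ∈ F
  · have hsub : F ⊆ {∅, A, B, A ∆ B} := fun C hC => by
      simpa using (key C (hmem C hC) (hF A hA.2 C hC) (hF B hB.2 C hC)).2 (hF _ hD C hC)
    have := card_le_card hsub
    have := card_le_four (a := ∅) (b := A) (c := B) (d := A ∆ B)
    omega
  · refine ⟨A ∩ B, fun C hC => ?_⟩
    refine (key C (hmem C hC) (hF A hA.2 C hC) (hF B hB.2 C hC)).1.resolve_right ?_
    rintro rfl
    exact hD hC

/-- Seven words of an extended Hamming code that represent the nonzero cosets of the affine code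
in a Nordstrom-Robinson code containing zero. -/
structure IsFrame (v : Fin 16 ≃ (Fin 4 → ZMod 2)) (a : Fin 7 → Word) : Prop where
  mem : ∀ i, a i ∈ hammingCode v
  norm : ∀ i, hammingNorm (a i) % 4 = 2
  dot : ∀ i j, i ≠ j → a i ⬝ᵥ a j = 1

lemma sum_add_sum_symmDiff (a : Fin 7 → Word) (S T : Finset (Fin 7)) :
    ∑ i ∈ S, a i + ∑ i ∈ T, a i = ∑ i ∈ S ∆ T, a i := by
  have h : ∀ S : Finset (Fin 7), ∑ i ∈ S, a i = ∑ i, if i ∈ S then a i else 0 := fun S => by simp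
  rw [h, h, h, ← sum_add_distrib]
  refine sum_congr rfl fun i _ => ?_
  by_cases h1 : i ∈ S <;> by_cases h2 : i ∈ T <;> simp [h1, h2, mem_symmDiff, add_self_word]

namespace IsFrame

variable {v : Fin 16 ≃ (Fin 4 → ZMod 2)} {a : Fin 7 → Word} (ha : IsFrame v a)
include ha

lemma sum_mem (S : Finset (Fin 7)) : ∑ i ∈ S, a i ∈ hammingCode v :=
  AddSubgroup.sum_mem _ fun i _ => ha.mem i

lemma dot_self (i : Fin 7) : a i ⬝ᵥ a i = 0 := by
  have h : ∀ c : ZMod 2, c * c = c := by decide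
  rw [dotProduct, sum_congr rfl fun j _ => h (a i j)]
  exact (ha.mem i).1

lemma sum_dot (S : Finset (Fin 7)) (j : Fin 7) :
    (∑ i ∈ S, a i) ⬝ᵥ a j = #S + if j ∈ S then 1 else 0 := by
  have h : ∀ i, a i ⬝ᵥ a j = 1 + if j = i then 1 else 0 := by
    intro i
    split_ifs with h
    · rw [h, ha.dot_self]; rfl
    · rw [ha.dot i j (Ne.symm h), add_zero]
  rw [sum_dotProduct, sum_congr rfl fun i _ => h i, sum_add_distrib, sum_ite_eq]
  simp

lemma norm_sum (S : Finset (Fin 7)) : hammingNorm (∑ i ∈ S, a i) % 4 = #S * (#S + 1) % 4 := by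
  induction S using Finset.induction_on with
  | empty => simp
  | insert j S hj ih =>
    obtain ⟨k, hk, h⟩ := hammingNorm_add_dot (∑ i ∈ S, a i) (a j)
    rw [ha.sum_dot, if_neg hj, add_zero, ZMod.natCast_eq_natCast_iff'] at hk
    have h2 := ha.norm j
    rw [sum_insert hj, card_insert_of_notMem hj, add_comm (a j)]
    have h3 : (#S + 1) * (#S + 1 + 1) = #S * (#S + 1) + 2 * #S + 2 := by ring
    rw [h3]
    omega

/-- Such a sum is orthogonal to every `a j`, so by `sum_dot` membership of `j` in `S` does not
depend on `j`. -/
lemma eq_empty_or_univ {S : Finset (Fin 7)} (hS : ∑ i ∈ S, a i ∈ affineCode v) :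
    S = ∅ ∨ S = univ := by
  by_contra! h
  obtain ⟨j, hj⟩ := h.1
  obtain ⟨k, hk⟩ : ∃ k, k ∉ S := by
    by_contra! h2
    exact h.2 (eq_univ_iff_forall.2 h2)
  have h1 := ha.sum_dot S j
  have h2 := ha.sum_dot S k
  rw [dotProduct_comm, dotProduct_eq_zero v (ha.mem _) hS] at h1 h2
  rw [if_pos hj] at h1
  rw [if_neg hk, add_zero] at h2
  rw [← h2] at h1
  exact absurd h1 (by decide)

/-- Excluding the point 0 selects one set from each complementary pair. The map from sets and affine
words is then injective, and `64 * 32 = 2048` makes it surjective. -/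
lemma exists_sum_add (h : Word) (hh : h ∈ hammingCode v) :
    ∃ S : Finset (Fin 7), 0 ∉ S ∧ h + ∑ i ∈ S, a i ∈ affineCode v := by
  let f : {S : Finset (Fin 7) // 0 ∉ S} × affineCode v → hammingCode v := fun p =>
    ⟨∑ i ∈ p.1.1, a i + p.2, add_mem (ha.sum_mem _) (affineCode_le_hammingCode v p.2.2)⟩
  have hf : Function.Injective f := by
    rintro ⟨⟨S, hS⟩, r⟩ ⟨⟨T, hT⟩, r'⟩ h
    have h1 : ∑ i ∈ S, a i + (r : Word) = ∑ i ∈ T, a i + (r' : Word) := congrArg Subtype.val h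
    have h2 : ∑ i ∈ S ∆ T, a i = r + r' := by
      rw [← sum_add_sum_symmDiff]
      calc _ = (∑ i ∈ S, a i + (r : Word)) + ∑ i ∈ T, a i + r := by
            rw [add_right_comm _ (r : Word), add_assoc _ (r : Word), add_self_word, add_zero]
        _ = _ := by
            rw [h1, add_right_comm (∑ i ∈ T, a i), add_self_word, zero_add, add_comm]
    have h3 : S ∆ T = ∅ := by
      refine (ha.eq_empty_or_univ (S := S ∆ T) ?_).resolve_right fun h => ?_
      · rw [h2]; exact add_mem r.2 r'.2
      · have := mem_univ (0 : Fin 7)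
        rw [← h, mem_symmDiff] at this
        tauto
    have h4 : S = T := symmDiff_eq_bot.1 h3
    subst h4
    rw [Subtype.ext (add_left_cancel h1)]
  have hcard : Nat.card (hammingCode v) ≤ Nat.card ({S : Finset (Fin 7) // 0 ∉ S} × affineCode v) := by
    rw [card_hammingCode, Nat.card_prod, card_affineCode, Nat.card_eq_fintype_card]
    have : Fintype.card {S : Finset (Fin 7) // 0 ∉ S} = 64 := by decide +kernel
    rw [this]
  have hb := hf.bijective_of_nat_card_le hcard
  obtain ⟨⟨⟨S, hS⟩, r⟩, hr⟩ := hb.2 ⟨h, hh⟩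
  have hr' : ∑ i ∈ S, a i + (r : Word) = h := congrArg Subtype.val hr
  refine ⟨S, hS, ?_⟩
  rw [← hr', add_right_comm, add_self_word, zero_add]
  exact r.2

lemma sum_univ_mem : ∑ i, a i ∈ affineCode v := by
  obtain ⟨S, h0, hS⟩ := ha.exists_sum_add (a 0) (ha.mem 0)
  rw [← sum_insert h0] at hS
  rcases ha.eq_empty_or_univ hS with h | h
  · exact absurd h (insert_ne_empty 0 S)
  · rwa [h] at hS

lemma sum_mem_affineCode_iff {S : Finset (Fin 7)} :
    ∑ i ∈ S, a i ∈ affineCode v ↔ S = ∅ ∨ S = univ := by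
  refine ⟨ha.eq_empty_or_univ, ?_⟩
  rintro (rfl | rfl)
  · simp
  · exact ha.sum_univ_mem

end IsFrame

end NordstromRobinson

/-! ### Nordstrom-Robinson subcodes as translates of one of them. -/

namespace NordstromRobinson

open Finset
open scoped symmDiff

lemma mem_translate {t x : Word} {C : Set Word} : x ∈ translate t C ↔ t + x ∈ C := by
  constructor
  · rintro ⟨y, hy, rfl⟩
    exact (add_add_cancel_word t y).symm ▸ hy
  · exact fun h => ⟨t + x, h, add_add_cancel_word t x⟩

lemma hammingDist_eq (x y : Word) : hammingDist x y = hammingNorm (x + y) := by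
  rw [hammingDist_eq_hammingNorm, CharTwo.neg_eq]

lemma ncard_translate (t : Word) (C : Set Word) : (translate t C).ncard = C.ncard :=
  Set.ncard_image_of_injective C (add_right_injective t)

lemma IsNordstromRobinson.translate {C : Set Word} (hC : IsNordstromRobinson C) (t : Word) :
    IsNordstromRobinson (translate t C) := by
  refine ⟨by rw [ncard_translate, hC.ncard_eq], ?_⟩
  convert hC.minDist_eq using 1
  ext d
  have h : ∀ x y : Word, t + x + (t + y) = x + y := fun x y => by
    rw [add_add_add_comm, add_self_word, zero_add]
  constructor
  · rintro ⟨_, ⟨x, hx, rfl⟩, _, ⟨y, hy, rfl⟩, hne, hd⟩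
    refine ⟨x, hx, y, hy, fun e => hne (by rw [e]), ?_⟩
    simpa only [hammingDist_eq, h] using hd
  · rintro ⟨x, hx, y, hy, hne, hd⟩
    refine ⟨t + x, ⟨x, hx, rfl⟩, t + y, ⟨y, hy, rfl⟩, fun e => hne (add_left_cancel e), ?_⟩
    simpa only [hammingDist_eq, h] using hd

lemma IsNordstromRobinson.nonempty {C : Set Word} (hC : IsNordstromRobinson C) : C.Nonempty := by
  rw [← Set.ncard_pos (Set.toFinite C), hC.ncard_eq]
  norm_num

variable {v : Fin 16 ≃ (Fin 4 → ZMod 2)}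

open Classical in
lemma IsNordstromRobinson.isOptimalEven {C : Set Word} (hC : IsNordstromRobinson C)
    (hH : C ⊆ hammingCode v) : IsOptimalEven C.toFinset where
  card_eq := by rw [← Set.ncard_eq_toFinset_card', hC.ncard_eq]
  even x hx := even_of_mem v (hH (Set.mem_toFinset.1 hx))
  le_dist x hx y hy h := by
    rw [← hammingDist_eq]
    exact hC.minDist_eq.2 ⟨x, Set.mem_toFinset.1 hx, y, Set.mem_toFinset.1 hy, h, rfl⟩

/-- A Nordstrom-Robinson subcode of an extended Hamming code is invariant under its dual. -/
lemma IsNordstromRobinson.add_mem_iff {C : Set Word} (hC : IsNordstromRobinson C)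
    (hH : C ⊆ hammingCode v) {r x : Word} (hr : r ∈ affineCode v) : r + x ∈ C ↔ x ∈ C := by
  classical
  have h : ∀ {x}, x ∈ C → r + x ∈ C := fun {x} hx => Set.mem_toFinset.1
    ((hC.isOptimalEven hH).add_mem (fun y hy => hH (Set.mem_toFinset.1 hy)) hr
      (Set.mem_toFinset.2 hx))
  exact ⟨fun hx => add_add_cancel_word r x ▸ h hx, h⟩

lemma IsNordstromRobinson.add_mem_or {C : Set Word} (hC : IsNordstromRobinson C)
    (hH : C ⊆ hammingCode v) {x y : Word} (hx : x ∈ C) (hy : y ∈ C) :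
    x + y ∈ affineCode v ∨ hammingNorm (x + y) % 4 = 2 := by
  classical
  exact (hC.isOptimalEven hH).add_mem_or (fun y hy => hH (Set.mem_toFinset.1 hy))
    (Set.mem_toFinset.2 hx) (Set.mem_toFinset.2 hy)

lemma ncard_affineCode : (affineCode v : Set Word).ncard = 32 := card_affineCode

/-- Cosets of the affine code cover a set of `256` words only if there are at least eight. -/
lemma le_card_of_cover {ι : Type*} {C : Set Word} (hC : C.ncard = 256) (s : Finset ι)
    (t : ι → Word) (h : C ⊆ ⋃ i ∈ s, translate (t i) (affineCode v)) : 8 ≤ #s := by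
  have h1 : C.ncard ≤ #s * 32 := by
    refine (Set.ncard_le_ncard h (Set.toFinite _)).trans ?_
    refine (set_ncard_biUnion_le s _).trans ?_
    simp_rw [ncard_translate, ncard_affineCode]
    simp
  omega

lemma IsNordstromRobinson.exists_rep {N : Set Word} (hN : IsNordstromRobinson N) (h0 : 0 ∈ N)
    (hH : N ⊆ hammingCode v) : ∃ a : Fin 7 → Word,
      N = (affineCode v : Set Word) ∪ ⋃ i, NordstromRobinson.translate (a i) (affineCode v) := by
  let π : Word → Word ⧸ affineCode v := QuotientAddGroup.mk
  have hπ : ∀ x y, π x = π y ↔ x + y ∈ affineCode v := fun x y => by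
    rw [QuotientAddGroup.eq, CharTwo.neg_eq]
  have hmem : ∀ x y, π x = π y → x ∈ N → y ∈ N := by
    intro x y h hx
    rw [hπ] at h
    rw [← hN.add_mem_iff hH h, add_comm (x + y), add_add_cancel_word] at hx
    exact hx
  have hpre : π ⁻¹' (π '' N) = N := by
    ext y
    constructor
    · rintro ⟨x, hx, h⟩
      exact hmem x y h hx
    · exact fun hy => ⟨y, hy, rfl⟩
  have hcard : (π '' N).ncard = 8 := by
    have h := Nat.card_congr
      (QuotientAddGroup.preimageMkEquivAddSubgroupProdSet (affineCode v) (π '' N))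
    rw [Nat.card_prod] at h
    have h2 : Nat.card (π ⁻¹' (π '' N)) = 256 := by rw [hpre]; exact hN.ncard_eq
    rw [card_affineCode] at h
    change Nat.card (π ⁻¹' (π '' N)) = 32 * (π '' N).ncard at h
    omega
  have hcard7 : Nat.card ↥(π '' N \ {π 0}) = Nat.card (Fin 7) := by
    rw [Nat.card_fin]
    change (π '' N \ {π 0}).ncard = 7
    rw [Set.ncard_sdiff_singleton_of_mem (Set.mem_image_of_mem π h0), hcard]
  obtain ⟨e⟩ := Finite.card_eq.1 hcard7
  have hchoice : ∀ i : Fin 7, ∃ x ∈ N, π x = e.symm i := fun i => (e.symm i).2.1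
  choose a haN ha using hchoice
  refine ⟨a, Set.Subset.antisymm ?_ ?_⟩
  · intro x hx
    by_cases hx0 : π x = π 0
    · left
      rw [hπ, add_zero] at hx0
      exact hx0
    · right
      refine Set.mem_iUnion.2 ⟨e ⟨π x, ⟨x, hx, rfl⟩, hx0⟩, ?_⟩
      rw [mem_translate]
      refine (hπ _ _).1 ?_
      rw [ha, e.symm_apply_apply]
  · rintro x (hx | hx)
    · refine hmem 0 x ((hπ _ _).2 ?_) h0
      rwa [zero_add]
    · obtain ⟨i, hi⟩ := Set.mem_iUnion.1 hx
      rw [mem_translate] at hi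
      exact hmem _ _ ((hπ _ _).2 hi) (haN i)

section Rep

variable {N : Set Word} {a : Fin 7 → Word}
  (hrep : N = (affineCode v : Set Word) ∪ ⋃ i, NordstromRobinson.translate (a i) (affineCode v))

include hrep

lemma mem_of_rep (x : Word) : x ∈ N ↔ x ∈ affineCode v ∨ ∃ i, a i + x ∈ affineCode v := by
  rw [hrep]
  simp [mem_translate]

lemma mem_iff_exists_sum (x : Word) :
    x ∈ N ↔ ∃ O : Finset (Fin 7), #O ≤ 1 ∧ ∑ i ∈ O, a i + x ∈ affineCode v := by
  rw [mem_of_rep hrep]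
  constructor
  · rintro (h | ⟨i, h⟩)
    · exact ⟨∅, by simp, by simpa using h⟩
    · exact ⟨{i}, by simp, by simpa using h⟩
  · rintro ⟨O, hO, h⟩
    rcases card_le_one_iff_subset_singleton.1 hO with ⟨i, hi⟩
    rcases subset_singleton_iff.1 hi with rfl | rfl
    · exact Or.inl (by simpa using h)
    · exact Or.inr ⟨i, by simpa using h⟩

lemma rep_mem (i : Fin 7) : a i ∈ N :=
  (mem_of_rep hrep _).2 (Or.inr ⟨i, by rw [add_self_word]; exact zero_mem _⟩)

lemma IsNordstromRobinson.isFrame (hN : IsNordstromRobinson N) (hH : N ⊆ hammingCode v) :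
    IsFrame v a := by
  -- Here `none` stands for the affine code itself. If two of the eight cosets coincided, seven
  -- would cover `N`, which is too few.
  have hcov : ∀ j : Fin 7, ∀ t : Option (Fin 7), t ≠ some j →
      t.elim 0 a + a j ∉ affineCode v := by
    intro j t htj ht
    have h := le_card_of_cover (v := v) hN.ncard_eq ((univ : Finset (Option (Fin 7))).erase (some j))
      (fun o => o.elim 0 a) ?_
    · rw [card_erase_of_mem (mem_univ _)] at h
      simp at h
    · intro x hx
      have key : ∀ o : Option (Fin 7), o ≠ some j → o.elim 0 a + x ∈ affineCode v →
          x ∈ ⋃ i ∈ (univ : Finset (Option (Fin 7))).erase (some j),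
            NordstromRobinson.translate (i.elim 0 a) (affineCode v : Set Word) := by
        intro o ho h
        exact Set.mem_biUnion (x := o) (by simp [ho]) (mem_translate.2 h)
      rcases (mem_of_rep hrep x).1 hx with h | ⟨i, h⟩
      · exact key none (by simp) (by simpa using h)
      · by_cases hij : i = j
        · subst hij
          refine key t htj ?_
          have := add_mem ht h
          rwa [add_assoc, add_add_cancel_word] at this
        · exact key (some i) (by simpa using hij) h
  have h0 : (0 : Word) ∈ N := (mem_of_rep hrep 0).2 (Or.inl (zero_mem _))
  have hn : ∀ i, hammingNorm (a i) % 4 = 2 := by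
    intro i
    have h1 := hcov i none (by simp)
    have h2 := hN.add_mem_or hH h0 (rep_mem hrep i)
    rw [zero_add] at h2
    refine h2.resolve_left ?_
    simpa using h1
  refine ⟨fun i => hH (rep_mem hrep i), hn, fun i j hij => ?_⟩
  have h1 := hcov j (some i) (by simpa using hij)
  have h2 := (hN.add_mem_or hH (rep_mem hrep i) (rep_mem hrep j)).resolve_left h1
  obtain ⟨k, hk, h⟩ := hammingNorm_add_dot (a i) (a j)
  have h3 := hn i
  have h4 := hn j
  rw [← hk, ← Nat.cast_one, ZMod.natCast_eq_natCast_iff']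
  omega

/-- The classes in `N` are those of the sets of size at most 1, and a class determines its set only
up to complement; hence the second alternative. -/
lemma mem_translate_sum_iff (ha : IsFrame v a) {x : Word} {S L : Finset (Fin 7)}
    (hS : x + ∑ i ∈ S, a i ∈ affineCode v) :
    x ∈ translate (∑ i ∈ L, a i) N ↔ #(S ∆ L) ≤ 1 ∨ 6 ≤ #(S ∆ L) := by
  have key : ∀ O : Finset (Fin 7), ∑ i ∈ O, a i + (∑ i ∈ L, a i + x) ∈ affineCode v ↔
      O ∆ (S ∆ L) = ∅ ∨ O ∆ (S ∆ L) = univ := by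
    intro O
    rw [← ha.sum_mem_affineCode_iff, ← sum_add_sum_symmDiff a O, ← sum_add_sum_symmDiff a S,
      ← AddSubgroup.add_mem_cancel_right (affineCode v) hS]
    have : ∑ i ∈ O, a i + (∑ i ∈ L, a i + x) + (x + ∑ i ∈ S, a i) =
        ∑ i ∈ O, a i + (∑ i ∈ S, a i + ∑ i ∈ L, a i) := by
      calc _ = ∑ i ∈ O, a i + (∑ i ∈ S, a i + ∑ i ∈ L, a i) + (x + x) := by abel
        _ = _ := by rw [add_self_word, add_zero]
    rw [this]
  rw [mem_translate, mem_iff_exists_sum hrep]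
  simp_rw [key]
  have hc := card_add_card_compl (S ∆ L)
  rw [Fintype.card_fin] at hc
  constructor
  · rintro ⟨O, hO, h | h⟩
    · rw [← bot_eq_empty, symmDiff_eq_bot] at h
      exact Or.inl (h ▸ hO)
    · rw [← top_eq_univ, symmDiff_eq_top] at h
      have : O = (S ∆ L)ᶜ := h.eq_compl
      rw [this] at hO
      omega
  · rintro (h | h)
    · exact ⟨S ∆ L, h, Or.inl (symmDiff_self _)⟩
    · exact ⟨(S ∆ L)ᶜ, by omega, Or.inr (compl_symmDiff_self _)⟩

lemma ker_eq_affineCode (hN : IsNordstromRobinson N) (hH : N ⊆ hammingCode v) (ha : IsFrame v a) :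
    ker N = affineCode v := by
  ext x
  have h0 : (0 : Word) ∈ N := (mem_of_rep hrep 0).2 (Or.inl (zero_mem _))
  constructor
  · intro hx
    have hx' : translate x N = N := hx
    have hxN : x ∈ N := by
      rw [← hx', mem_translate, add_self_word]
      exact h0
    rcases (mem_of_rep hrep x).1 hxN with h | ⟨i, hi⟩
    · exact h
    exfalso
    -- If the coset of `a i` were in the kernel, `a i + N` would contain `a j`, although `{i, j}`
    -- has size 2.
    obtain ⟨j, hj⟩ := exists_ne i
    have hS : a j + ∑ k ∈ {j}, a k ∈ affineCode v := by
      rw [sum_singleton, add_self_word]; exact zero_mem _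
    have h1 : a j ∈ translate (∑ k ∈ {i}, a k) N := by
      have h2 : a j ∈ translate x N := hx'.symm ▸ rep_mem hrep j
      rw [mem_translate] at h2 ⊢
      rw [← hN.add_mem_iff hH hi] at h2
      rwa [sum_singleton, ← add_add_cancel_word x (a j), ← add_assoc]
    rw [mem_translate_sum_iff hrep ha hS] at h1
    have h2 : ({j} : Finset (Fin 7)) ∆ {i} = {j, i} := by
      ext k
      simp only [mem_symmDiff, mem_singleton, mem_insert]
      constructor
      · tauto
      · rintro (rfl | rfl)
        · exact Or.inl ⟨rfl, hj⟩
        · exact Or.inr ⟨rfl, hj.symm⟩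
    rw [h2, card_pair hj] at h1
    omega
  · intro hx
    change translate x N = N
    ext y
    rw [mem_translate, hN.add_mem_iff hH hx]

/-- Every Nordstrom-Robinson subcode of the extended Hamming code is a translate of `N`. -/
lemma exists_translate_eq (hN : IsNordstromRobinson N) (ha : IsFrame v a) {M : Set Word}
    (hM : IsNordstromRobinson M) (hMH : M ⊆ hammingCode v) :
    ∃ T : Finset (Fin 7), M = translate (∑ i ∈ T, a i) N := by
  classical
  obtain ⟨m, hm⟩ := hM.nonempty
  obtain ⟨U, -, hU⟩ := ha.exists_sum_add m (hMH hm)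
  have hshift : ∀ x S, (m + x + ∑ i ∈ S, a i ∈ affineCode v ↔
      x + ∑ i ∈ S ∆ U, a i ∈ affineCode v) := by
    intro x S
    rw [← sum_add_sum_symmDiff, ← AddSubgroup.add_mem_cancel_right (affineCode v) hU]
    have : m + x + ∑ i ∈ S, a i + (m + ∑ i ∈ U, a i) =
      x + (∑ i ∈ S, a i + ∑ i ∈ U, a i) + (m + m) := by abel
    rw [this, add_self_word, add_zero]
  let F : Finset (Finset (Fin 7)) := {S | #S ≤ 2 ∧ m + ∑ i ∈ S, a i ∈ M}
  -- A sum of `k` representatives has weight `k(k+1)` modulo 4, which is 0 for `k = 3, 4`, whereas a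
  -- bent difference has weight 2 modulo 4.
  have hdiff : ∀ S T : Finset (Fin 7), m + ∑ i ∈ S, a i ∈ M → m + ∑ i ∈ T, a i ∈ M →
      #(S ∆ T) ≠ 3 ∧ #(S ∆ T) ≠ 4 := by
    intro S T hS hT
    have h := hM.add_mem_or hMH hS hT
    rw [add_add_add_comm, add_self_word, zero_add, sum_add_sum_symmDiff, ha.norm_sum,
      ha.sum_mem_affineCode_iff] at h
    rcases h with (h | h) | h
    · simp [h]
    · simp [h]
    · constructor <;> intro e <;> simp [e] at h
  have hempty : ∅ ∈ F := by simp [F, hm]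
  have hcover : ∀ x ∈ M, ∃ S ∈ F, x + m + ∑ i ∈ S, a i ∈ affineCode v := by
    intro x hx
    obtain ⟨S, -, hS⟩ := ha.exists_sum_add (x + m) (add_mem (hMH hx) (hMH hm))
    have hin : ∀ S : Finset (Fin 7), x + m + ∑ i ∈ S, a i ∈ affineCode v →
        m + ∑ i ∈ S, a i ∈ M := by
      intro S hS
      have h := (hM.add_mem_iff hMH hS).2 hx
      rwa [add_assoc x, add_comm, add_add_cancel_word] at h
    have hS1 := hdiff S ∅ (hin S hS) (by simpa using hm)
    rw [← bot_eq_empty, symmDiff_bot] at hS1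
    by_cases h2 : #S ≤ 2
    · exact ⟨S, by simp [F, h2, hin S hS], hS⟩
    · have hSc : x + m + ∑ i ∈ Sᶜ, a i ∈ affineCode v := by
        have h := add_mem hS ha.sum_univ_mem
        rw [add_assoc, sum_add_sum_symmDiff] at h
        rwa [← top_eq_univ, symmDiff_top] at h
      refine ⟨Sᶜ, ?_, hSc⟩
      have hc := card_add_card_compl S
      rw [Fintype.card_fin] at hc
      simp only [F, mem_filter, mem_univ, true_and]
      exact ⟨by omega, hin _ hSc⟩
  have h8 : 8 ≤ #F := by
    refine le_card_of_cover (v := v) hM.ncard_eq F (fun S => m + ∑ i ∈ S, a i) fun x hx => ?_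
    obtain ⟨S, hSF, hS⟩ := hcover x hx
    refine Set.mem_biUnion hSF (mem_translate.2 ?_)
    change m + ∑ i ∈ S, a i + x ∈ affineCode v
    rwa [add_right_comm, add_comm m x]
  obtain ⟨T, hT⟩ := exists_center (by omega) hempty (fun A hA => (mem_filter.1 hA).2.1) (by
    intro A hA B hB
    have h1 := (mem_filter.1 hA).2
    have h2 := (mem_filter.1 hB).2
    have h3 := hdiff A B h1.2 h2.2
    have h4 : #(A ∆ B) ≤ #A + #B := (card_le_card symmDiff_le_sup).trans (card_union_le _ _)
    omega)
  -- `U` is the class of the base point `m`, and `T` the centre seen from it. Inclusion suffices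
  -- because both codes have 256 words.
  refine ⟨U ∆ T, Set.eq_of_subset_of_ncard_le ?_ ?_ (Set.toFinite _)⟩
  · intro x hx
    obtain ⟨S, hSF, hS⟩ := hcover x hx
    rw [add_comm x, hshift] at hS
    rw [mem_translate_sum_iff hrep ha hS, symmDiff_assoc, symmDiff_symmDiff_cancel_left]
    exact Or.inl (hT S hSF)
  · rw [ncard_translate, hN.ncard_eq, hM.ncard_eq]

end Rep

end NordstromRobinson

/-! ### Fano planes as perfect codes up to complement. -/

namespace NordstromRobinson

open Finset
open scoped symmDiff

lemma card_symmDiff_add (A B : Finset (Fin 7)) : #(A ∆ B) + 2 * #(A ∩ B) = #A + #B := by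
  have h1 := card_union_add_card_inter A B
  have h2 : #(A ∆ B) + #(A ∩ B) = #(A ∪ B) := by
    rw [symmDiff_eq_sup_sdiff_inf]
    exact card_sdiff_add_card_eq_card inter_subset_union
  omega

lemma card_union_le_seven (A B : Finset (Fin 7)) : #A + #B ≤ 7 + #(A ∩ B) := by
  have h1 := card_union_add_card_inter A B
  have h2 := card_le_univ (A ∪ B)
  rw [Fintype.card_fin] at h2
  omega

lemma card_symmDiff_le_two {S A B : Finset (Fin 7)} (hA : #(S ∆ A) ≤ 1 ∨ 6 ≤ #(S ∆ A))
    (hB : #(S ∆ B) ≤ 1 ∨ 6 ≤ #(S ∆ B)) : #(A ∆ B) ≤ 2 ∨ 5 ≤ #(A ∆ B) := by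
  have h : (S ∆ A) ∆ (S ∆ B) = A ∆ B := by
    rw [symmDiff_comm S A, symmDiff_assoc, symmDiff_symmDiff_cancel_left]
  have h1 := card_symmDiff_add (S ∆ A) (S ∆ B)
  have h2 := card_union_le_seven (S ∆ A) (S ∆ B)
  have h3 := card_le_card (inter_subset_left (s₁ := S ∆ A) (s₂ := S ∆ B))
  have h4 := card_le_card (inter_subset_right (s₁ := S ∆ A) (s₂ := S ∆ B))
  rw [h] at h1
  omega

namespace IsFanoPlane

variable {S : Set (Finset (Fin 7))} (hS : IsFanoPlane S)
include hS

lemma eq_of_mem {p q : Fin 7} (hpq : p ≠ q) {L M : Finset (Fin 7)} (hL : L ∈ S) (hM : M ∈ S)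
    (hpL : p ∈ L) (hqL : q ∈ L) (hpM : p ∈ M) (hqM : q ∈ M) : L = M :=
  (hS.exists_unique_line p q hpq).unique ⟨hL, hpL, hqL⟩ ⟨hM, hpM, hqM⟩

lemma exists_third {p q : Fin 7} (hpq : p ≠ q) : ∃ x, x ≠ p ∧ x ≠ q ∧ {p, q, x} ∈ S := by
  obtain ⟨L, ⟨hL, hp, hq⟩, -⟩ := hS.exists_unique_line p q hpq
  have hsub : {p, q} ⊆ L := by
    intro x hx
    rcases mem_insert.1 hx with rfl | hx
    · exact hp
    · exact mem_singleton.1 hx ▸ hq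
  have hc : #(L \ {p, q}) = 1 := by
    rw [card_sdiff_of_subset hsub, hS.card_line L hL, card_pair hpq]
  obtain ⟨x, hx⟩ := card_eq_one.1 hc
  have hx' : x ∈ L \ {p, q} := hx ▸ mem_singleton_self x
  rw [mem_sdiff, mem_insert, mem_singleton, not_or] at hx'
  refine ⟨x, hx'.2.1, hx'.2.2, ?_⟩
  have : {p, q, x} = L := by
    rw [← sdiff_union_of_subset hsub, hx]
    ext y
    simp only [mem_insert, mem_singleton, mem_union]
    tauto
  rwa [this]

/-- Disjoint lines would miss a single point `z`. Every line joining `p` in `L` to a point of `M`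
would pass through `z`, giving two lines through `p` and `z`. -/
lemma inter_nonempty {L M : Finset (Fin 7)} (hL : L ∈ S) (hM : M ∈ S) : (L ∩ M).Nonempty := by
  by_contra hne
  rw [not_nonempty_iff_eq_empty] at hne
  have hdisj : ∀ x, x ∈ L → x ∉ M := fun x h1 h2 => by
    have := mem_inter.2 ⟨h1, h2⟩
    rw [hne] at this
    exact notMem_empty x this
  have h1 := card_union_add_card_inter L M
  rw [hne, hS.card_line L hL, hS.card_line M hM, card_empty] at h1
  have h2 := card_add_card_compl (L ∪ M)
  rw [Fintype.card_fin] at h2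
  obtain ⟨z, hz⟩ := card_eq_one.1 (show #(L ∪ M)ᶜ = 1 by omega)
  have hout : ∀ x, x ∉ L → x ∉ M → x = z := fun x h3 h4 => by
    rw [← mem_singleton, ← hz, mem_compl, mem_union]
    tauto
  obtain ⟨p, hp⟩ := card_pos.1 (show 0 < #L by rw [hS.card_line L hL]; norm_num)
  obtain ⟨q, hq, q', hq', hqq⟩ := one_lt_card.1 (show 1 < #M by rw [hS.card_line M hM]; norm_num)
  have hthird : ∀ q ∈ M, {p, q, z} ∈ S := by
    intro q hq
    have hpq : p ≠ q := fun h => hdisj p hp (h ▸ hq)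
    obtain ⟨w, hwp, hwq, hw⟩ := hS.exists_third hpq
    have : w = z := by
      refine hout w (fun h => ?_) (fun h => ?_)
      · have e := hS.eq_of_mem hwp.symm hL hw hp h (by simp) (by simp)
        exact hdisj q (e ▸ by simp) hq
      · have e := hS.eq_of_mem hwq.symm hM hw hq h (by simp) (by simp)
        exact hdisj p hp (e ▸ by simp)
    rwa [← this]
  have hzp : p ≠ z := by
    rintro rfl
    have := mem_singleton_self p
    rw [← hz, mem_compl, mem_union] at this
    exact this (Or.inl hp)
  have hzq : q' ≠ z := by
    rintro rfl
    have := mem_singleton_self q'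
    rw [← hz, mem_compl, mem_union] at this
    exact this (Or.inr hq')
  have e := hS.eq_of_mem hzp (hthird q hq) (hthird q' hq') (by simp) (by simp) (by simp) (by simp)
  have : q' ∈ ({p, q, z} : Finset (Fin 7)) := e ▸ by simp
  simp only [mem_insert, mem_singleton] at this
  rcases this with rfl | rfl | rfl
  · exact hdisj _ hp hq'
  · exact hqq rfl
  · exact hzq rfl

lemma card_symmDiff {L M : Finset (Fin 7)} (hL : L ∈ S) (hM : M ∈ S) (h : L ≠ M) :
    #(L ∆ M) = 4 := by
  have h1 : #(L ∩ M) ≤ 1 := by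
    by_contra! h2
    obtain ⟨p, hp, q, hq, hpq⟩ := one_lt_card.1 h2
    rw [mem_inter] at hp hq
    exact h (hS.eq_of_mem hpq hL hM hp.1 hq.1 hp.2 hq.2)
  have h2 := card_pos.2 (hS.inter_nonempty hL hM)
  have h3 := card_symmDiff_add L M
  rw [hS.card_line L hL, hS.card_line M hM] at h3
  omega

/-- Join the third points `x`, `y` of two sides of the triangle. If that line met a vertex, it would
coincide with one of these sides. -/
lemma exists_disjoint_line {i j k : Fin 7} (hij : i ≠ j) (hik : i ≠ k) (hjk : j ≠ k)
    (hT : {i, j, k} ∉ S) : ∃ L ∈ S, {i, j, k} ∩ L = ∅ := by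
  obtain ⟨x, hxi, hxj, hx⟩ := hS.exists_third hij
  obtain ⟨y, hyi, hyk, hy⟩ := hS.exists_third hik
  have hxk : x ≠ k := by rintro rfl; exact hT hx
  have hyj : y ≠ j := by
    rintro rfl
    refine hT ?_
    rwa [pair_comm]
  have hxy : x ≠ y := by
    rintro rfl
    have e := hS.eq_of_mem hxi hx hy (by simp) (by simp) (by simp) (by simp)
    have : j ∈ ({i, k, x} : Finset (Fin 7)) := e ▸ by simp
    simp only [mem_insert, mem_singleton] at this
    tauto
  obtain ⟨z, hzx, hzy, hz⟩ := hS.exists_third hxy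
  have hy1 : y ∉ ({i, j, x} : Finset (Fin 7)) := by
    simp only [mem_insert, mem_singleton]; tauto
  have hx1 : x ∉ ({i, k, y} : Finset (Fin 7)) := by
    simp only [mem_insert, mem_singleton]; tauto
  have hzi : z ≠ i := by
    rintro rfl
    exact hy1 (hS.eq_of_mem hxi hz hx (by simp) (by simp) (by simp) (by simp) ▸ by simp)
  have hzj : z ≠ j := by
    rintro rfl
    exact hy1 (hS.eq_of_mem hxj hz hx (by simp) (by simp) (by simp) (by simp) ▸ by simp)
  have hzk : z ≠ k := by
    rintro rfl
    exact hx1 (hS.eq_of_mem hyk hz hy (by simp) (by simp) (by simp) (by simp) ▸ by simp)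
  refine ⟨_, hz, ?_⟩
  ext w
  simp only [mem_inter, mem_insert, mem_singleton, notMem_empty, iff_false]
  rintro ⟨rfl | rfl | rfl, h | h | h⟩ <;> simp_all

/-- The empty set and the lines form a covering of the subsets up to complements. -/
lemma exists_close_of_card_le (T : Finset (Fin 7)) (hT : #T ≤ 3) :
    ∃ L, (L = ∅ ∨ L ∈ S) ∧ (#(T ∆ L) ≤ 1 ∨ 6 ≤ #(T ∆ L)) := by
  obtain h | h | h : #T ≤ 1 ∨ #T = 2 ∨ #T = 3 := by omega
  · exact ⟨∅, Or.inl rfl, Or.inl (by rwa [← bot_eq_empty, symmDiff_bot])⟩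
  · obtain ⟨p, q, hpq, rfl⟩ := card_eq_two.1 h
    obtain ⟨L, ⟨hL, hp, hq⟩, -⟩ := hS.exists_unique_line p q hpq
    refine ⟨L, Or.inr hL, Or.inl ?_⟩
    have h1 := card_symmDiff_add {p, q} L
    have h2 : {p, q} ∩ L = {p, q} := by
      rw [inter_eq_left]
      intro x hx
      rcases mem_insert.1 hx with rfl | hx
      · exact hp
      · exact mem_singleton.1 hx ▸ hq
    rw [h2, h, hS.card_line L hL] at h1
    omega
  · by_cases hTS : T ∈ S
    · exact ⟨T, Or.inr hTS, Or.inl (by simp)⟩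
    · obtain ⟨i, j, k, hij, hik, hjk, rfl⟩ := card_eq_three.1 h
      obtain ⟨L, hL, hd⟩ := hS.exists_disjoint_line hij hik hjk hTS
      refine ⟨L, Or.inr hL, Or.inr ?_⟩
      have h1 := card_symmDiff_add {i, j, k} L
      rw [hd, h, hS.card_line L hL, card_empty] at h1
      omega

lemma exists_close (T : Finset (Fin 7)) :
    ∃ L, (L = ∅ ∨ L ∈ S) ∧ (#(T ∆ L) ≤ 1 ∨ 6 ≤ #(T ∆ L)) := by
  by_cases h : #T ≤ 3
  · exact hS.exists_close_of_card_le T h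
  · have hc := card_add_card_compl T
    rw [Fintype.card_fin] at hc
    obtain ⟨L, hL, h1⟩ := hS.exists_close_of_card_le Tᶜ (by omega)
    refine ⟨L, hL, ?_⟩
    have h2 : Tᶜ ∆ L = (T ∆ L)ᶜ := by
      ext x
      simp only [mem_symmDiff, mem_compl]
      tauto
    have h3 := card_add_card_compl (T ∆ L)
    rw [Fintype.card_fin] at h3
    rw [h2] at h1
    omega

end IsFanoPlane

lemma translate_zero (C : Set Word) : translate 0 C = C := by
  ext x; rw [mem_translate, zero_add]

lemma mem_lineFamily {N : Set Word} {a : Fin 7 → Word} {S : Set (Finset (Fin 7))} {C : Set Word} :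
    C ∈ lineFamily N a S ↔ ∃ L, (L = ∅ ∨ L ∈ S) ∧ C = translate (∑ i ∈ L, a i) N := by
  constructor
  · rintro (rfl | ⟨L, hL, rfl⟩)
    · exact ⟨∅, Or.inl rfl, by rw [sum_empty, translate_zero]⟩
    · exact ⟨L, Or.inr hL, rfl⟩
  · rintro ⟨L, rfl | hL, rfl⟩
    · rw [sum_empty, translate_zero]
      exact Set.mem_insert _ _
    · exact Or.inr ⟨L, hL, rfl⟩

/-! ### Partitions of the Hamming code and Fano planes. -/

section Partition

variable {v : Fin 16 ≃ (Fin 4 → ZMod 2)} {N : Set Word} {a : Fin 7 → Word}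

lemma isNRPartition_lineFamily (hN : IsNordstromRobinson N) (hH : N ⊆ hammingCode v)
    (hrep : N = (affineCode v : Set Word) ∪ ⋃ i, translate (a i) (affineCode v))
    {S : Set (Finset (Fin 7))} (hS : IsFanoPlane S) :
    IsNRPartition (lineFamily N a S) (hammingCode v) := by
  have ha := hN.isFrame hrep hH
  have hsub : ∀ L : Finset (Fin 7), translate (∑ i ∈ L, a i) N ⊆ hammingCode v := by
    rintro L _ ⟨x, hx, rfl⟩
    exact add_mem (ha.sum_mem L) (hH hx)
  refine ⟨fun C hC => ?_, fun C hC D hD hne => ?_, Set.Subset.antisymm ?_ ?_⟩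
  · obtain ⟨L, -, rfl⟩ := mem_lineFamily.1 hC
    exact hN.translate _
  · obtain ⟨L, hL, rfl⟩ := mem_lineFamily.1 hC
    obtain ⟨M, hM, rfl⟩ := mem_lineFamily.1 hD
    have hLM : L ≠ M := by rintro rfl; exact hne rfl
    refine Set.disjoint_left.2 fun x hxL hxM => ?_
    obtain ⟨T, -, hT⟩ := ha.exists_sum_add x (hsub L hxL)
    have h := card_symmDiff_le_two ((mem_translate_sum_iff hrep ha hT).1 hxL)
      ((mem_translate_sum_iff hrep ha hT).1 hxM)
    have h2 : #(L ∆ M) = 3 ∨ #(L ∆ M) = 4 := by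
      rcases hL with rfl | hL <;> rcases hM with rfl | hM
      · exact absurd rfl hLM
      · left
        rw [← bot_eq_empty, bot_symmDiff, hS.card_line M hM]
      · left
        rw [← bot_eq_empty, symmDiff_bot, hS.card_line L hL]
      · exact Or.inr (hS.card_symmDiff hL hM hLM)
    omega
  · rintro x ⟨C, hC, hx⟩
    obtain ⟨L, -, rfl⟩ := mem_lineFamily.1 hC
    exact hsub L hx
  · intro x hx
    obtain ⟨T, -, hT⟩ := ha.exists_sum_add x hx
    obtain ⟨L, hL, h⟩ := hS.exists_close T
    exact ⟨_, mem_lineFamily.2 ⟨L, hL, rfl⟩, (mem_translate_sum_iff hrep ha hT).2 h⟩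

lemma translate_sum_compl (hN : IsNordstromRobinson N) (hH : N ⊆ hammingCode v)
    (ha : IsFrame v a) (T : Finset (Fin 7)) :
    translate (∑ i ∈ Tᶜ, a i) N = translate (∑ i ∈ T, a i) N := by
  ext x
  rw [mem_translate, mem_translate, ← hN.add_mem_iff hH ha.sum_univ_mem, ← add_assoc,
    sum_add_sum_symmDiff]
  congr! 4
  rw [← top_eq_univ, symmDiff_comm, symmDiff_top, hnot_eq_compl, compl_compl]

/-- A Nordstrom-Robinson subcode of the extended Hamming code that is disjoint from `N` is the
translate of `N` by the sum of three of its seven coset representatives. -/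
lemma exists_card_three (hN : IsNordstromRobinson N) (hH : N ⊆ hammingCode v)
    (hrep : N = (affineCode v : Set Word) ∪ ⋃ i, translate (a i) (affineCode v))
    {C : Set Word} (hC : IsNordstromRobinson C) (hCH : C ⊆ hammingCode v) (hd : Disjoint C N) :
    ∃ L : Finset (Fin 7), #L = 3 ∧ C = translate (∑ i ∈ L, a i) N := by
  have ha := hN.isFrame hrep hH
  obtain ⟨T, hT, hCT⟩ : ∃ T : Finset (Fin 7), #T ≤ 3 ∧ C = translate (∑ i ∈ T, a i) N := by
    obtain ⟨T, hT⟩ := exists_translate_eq hrep hN ha hC hCH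
    by_cases h : #T ≤ 3
    · exact ⟨T, h, hT⟩
    · refine ⟨Tᶜ, ?_, by rw [translate_sum_compl hN hH ha, hT]⟩
      have hc := card_add_card_compl T
      rw [Fintype.card_fin] at hc
      omega
  refine ⟨T, ?_, hCT⟩
  by_contra h3
  -- For `#T < 3`, this `U` is within distance 1 of both `T` and `∅`, so its class lies in `C` and
  -- in `N`. Truncated subtraction covers `T = ∅`.
  obtain ⟨U, hUT, hU⟩ : ∃ U ⊆ T, #U = #T - 1 := exists_subset_card_eq (by omega)
  have hmem : ∑ i ∈ U, a i + ∑ i ∈ U, a i ∈ affineCode v := by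
    rw [add_self_word]; exact zero_mem _
  refine Set.disjoint_left.1 hd (?_ : ∑ i ∈ U, a i ∈ C) ?_
  · rw [hCT, mem_translate_sum_iff hrep ha hmem]
    have h1 := card_symmDiff_add U T
    rw [inter_eq_left.2 hUT] at h1
    omega
  · rw [← translate_zero N, ← sum_empty (f := a), mem_translate_sum_iff hrep ha hmem,
      ← bot_eq_empty, symmDiff_bot]
    omega

lemma exists_fanoPlane (hN : IsNordstromRobinson N) (hH : N ⊆ hammingCode v)
    (hrep : N = (affineCode v : Set Word) ∪ ⋃ i, translate (a i) (affineCode v))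
    {P : Set (Set Word)} (hP : IsNRPartition P (hammingCode v)) (hNP : N ∈ P) :
    ∃ S : Set (Finset (Fin 7)), IsFanoPlane S ∧ P = lineFamily N a S := by
  have ha := hN.isFrame hrep hH
  have hthree : ∀ C ∈ P, C ≠ N → ∃ L : Finset (Fin 7), #L = 3 ∧ C = translate (∑ i ∈ L, a i) N := by
    intro C hC hne
    refine exists_card_three hN hH hrep (hP.isNR C hC) ?_ (hP.disjoint hC hNP hne)
    rw [← hP.union_eq]
    exact Set.subset_sUnion_of_mem hC
  have hself : ∀ T : Finset (Fin 7), ∑ i ∈ T, a i + ∑ i ∈ T, a i ∈ affineCode v := fun T => by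
    rw [add_self_word]; exact zero_mem _
  refine ⟨{L | #L = 3 ∧ translate (∑ i ∈ L, a i) N ∈ P}, ⟨fun L hL => hL.1, fun p q hpq => ?_⟩, ?_⟩
  -- A pair is at distance 1, 3 or 5 from a triple, and only distance 1, which means containment,
  -- satisfies the ball condition. So lines through `p`, `q` are the members covering the class of
  -- `{p, q}`.
  · have hpair : ∀ L : Finset (Fin 7), #L = 3 →
        (∑ i ∈ {p, q}, a i ∈ translate (∑ i ∈ L, a i) N ↔ p ∈ L ∧ q ∈ L) := by
      intro L hL
      rw [mem_translate_sum_iff hrep ha (hself _)]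
      have h1 := card_symmDiff_add {p, q} L
      have h2 := card_pair hpq
      have h3 := card_le_card (inter_subset_left (s₁ := {p, q}) (s₂ := L))
      have h4 : #({p, q} ∩ L) = 2 ↔ p ∈ L ∧ q ∈ L := by
        rw [← h2]
        constructor
        · intro h
          have h5 := eq_of_subset_of_card_le inter_subset_left h.ge
          rw [inter_eq_left] at h5
          exact ⟨h5 (by simp), h5 (by simp)⟩
        · rintro ⟨hp, hq⟩
          rw [inter_eq_left.2]
          intro x hx
          rcases mem_insert.1 hx with rfl | hx
          · exact hp
          · exact mem_singleton.1 hx ▸ hq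
      rw [← h4]
      omega
    have hmem : ∑ i ∈ {p, q}, a i ∈ ⋃₀ P := by
      rw [hP.union_eq]; exact ha.sum_mem _
    obtain ⟨C, hC, hxC⟩ := hmem
    have hCN : C ≠ N := by
      rintro rfl
      rw [← translate_zero C, ← sum_empty (f := a), mem_translate_sum_iff hrep ha (hself _),
        ← bot_eq_empty, symmDiff_bot, card_pair hpq] at hxC
      omega
    obtain ⟨L, hL, rfl⟩ := hthree C hC hCN
    refine ⟨L, ⟨⟨hL, hC⟩, (hpair L hL).1 hxC⟩, ?_⟩
    rintro M ⟨⟨hM, hMP⟩, hpq'⟩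
    have heq : translate (∑ i ∈ L, a i) N = translate (∑ i ∈ M, a i) N :=
      hP.disjoint.elim_set hC hMP _ hxC ((hpair M hM).2 hpq')
    have h0 : ∑ i ∈ M, a i ∈ translate (∑ i ∈ L, a i) N := by
      rw [heq, mem_translate_sum_iff hrep ha (hself _)]
      simp
    rw [mem_translate_sum_iff hrep ha (hself _)] at h0
    have h1 := card_symmDiff_add M L
    have h2 : #({p, q} : Finset (Fin 7)) ≤ #(M ∩ L) := by
      refine card_le_card fun x hx => ?_
      have hL' := (hpair L hL).1 hxC
      rcases mem_insert.1 hx with rfl | hx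
      · exact mem_inter.2 ⟨hpq'.1, hL'.1⟩
      · rw [mem_singleton.1 hx]
        exact mem_inter.2 ⟨hpq'.2, hL'.2⟩
    rw [card_pair hpq] at h2
    -- Two common points bound this by 2, the ball condition then by 1, and for two triples it is
    -- even.
    have h3 : #(M ∆ L) = 0 := by omega
    exact symmDiff_eq_bot.1 (card_eq_zero.1 h3)
  · refine Set.Subset.antisymm (fun C hC => ?_) ?_
    · by_cases hCN : C = N
      · exact Or.inl hCN
      · obtain ⟨L, hL, rfl⟩ := hthree C hC hCN
        exact Or.inr ⟨L, ⟨hL, hC⟩, rfl⟩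
    · rintro C (rfl | ⟨L, hL, rfl⟩)
      · exact hNP
      · exact hL.2

end Partition

end NordstromRobinson

theorem theorem2 (N H : Set NordstromRobinson.Word)
    (hN : NordstromRobinson.IsNordstromRobinson N)
    (h0 : (0 : NordstromRobinson.Word) ∈ N)
    (hH : NordstromRobinson.IsExtendedHamming H)
    (hNH : N ⊆ H) :
    (∃ a : Fin 7 → NordstromRobinson.Word, NordstromRobinson.IsKernelRepresentation N a) ∧
    ∀ a : Fin 7 → NordstromRobinson.Word, NordstromRobinson.IsKernelRepresentation N a →
      (∀ S : Set (Finset (Fin 7)), NordstromRobinson.IsFanoPlane S →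
        NordstromRobinson.IsNRPartition (NordstromRobinson.lineFamily N a S) H) ∧
      (∀ P : Set (Set NordstromRobinson.Word), NordstromRobinson.IsNRPartition P H → N ∈ P →
        ∃ S : Set (Finset (Fin 7)), NordstromRobinson.IsFanoPlane S ∧
          P = NordstromRobinson.lineFamily N a S) := by
  obtain ⟨v, hv⟩ := hH
  have hv' : H = NordstromRobinson.hammingCode v := hv
  clear hv
  subst hv'
  obtain ⟨b, hb⟩ := hN.exists_rep h0 hNH
  have hker := NordstromRobinson.ker_eq_affineCode hb hN hNH (hN.isFrame hb hNH)
  have hiff : ∀ a, NordstromRobinson.IsKernelRepresentation N a ↔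
      N = (NordstromRobinson.affineCode v : Set NordstromRobinson.Word) ∪
        ⋃ i, NordstromRobinson.translate (a i) (NordstromRobinson.affineCode v) := fun a => by
    rw [NordstromRobinson.IsKernelRepresentation, hker]
  refine ⟨⟨b, (hiff b).2 hb⟩, fun a ha => ?_⟩
  rw [hiff] at ha
  exact ⟨fun S hS => NordstromRobinson.isNRPartition_lineFamily hN hNH ha hS,
    fun P hP hNP => NordstromRobinson.exists_fanoPlane hN hNH ha hP hNP⟩
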